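/- Let $n\ge 1$ and $a>0$, let $z=(z^1,\dots,z^n)$ be the standard coordinates on $\mathbb{C}^n\setminus\{0\}$, and put $u=|z|^2=\sum_\mu |z^\mu|^2$, $z_\mu=z^\mu$ and $\bar z_\mu=\overline{z^\mu}$. Consider on $\mathbb{C}^n\setminus\{0\}$ the (Calabi–Eguchi–Hanson) metric with components $$g_{\mu\bar\nu}=\sqrt[n]{1+\frac{a^n}{u^n}}\left(\delta_{\mu\bar\nu}-\frac{a^n}{a^n+u^n}\,\frac{\bar z_\mu z_\nu}{u}\right),$$ extended complex-bilinearly to the complexified tangent spaces by $g_{\bar\nu\mu}=g_{\mu\bar\nu}$ and $g_{\mu\nu}=g_{\bar\mu\bar\nu}=0$. Let $\nabla$ be its Levi-Civita connection and $R(X,Y)=\nabla_X\nabla_Y-\nabla_Y\nabla_X-\nabla_{[X,Y]}$. Write $\partial_\mu=\partial/\partial z^\mu$ and $\partial_{\bar\mu}=\partial/\partial\bar z^\mu$; denote by $\Gamma^\lambda_{\mu\alpha}$ the component of $\nabla_{\partial_\mu}\partial_\alpha$ along $\partial_\lambda$, and put $R_{\mu\bar\nu\alpha\bar\beta}=g\big(R(\partial_\alpha,\partial_{\bar\beta})\partial_\mu,\partial_{\bar\nu}\big)$.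 Then, at every point of $\mathbb{C}^n\setminus\{0\}$ and for all indices, the following hold. 1. The Christoffel symbols are $$\Gamma^\lambda_{\mu\alpha}=-\frac{a^n}{u(a^n+u^n)}\left(\bar z_\mu\,\delta^\lambda{}_\alpha+\bar z_\alpha\,\delta^\lambda{}_\mu-(n+1)\frac{\bar z_\alpha\bar z_\mu}{u}z^\lambda\right).$$ 2. The curvature tensor is $$\begin{aligned}R_{\mu\bar\nu\alpha\bar\beta}=\frac{a^n}{(a^n+u^n)^{\frac{n+1}{n}}}\Bigg(&g_{\alpha\bar\nu}g_{\mu\bar\beta}+g_{\mu\bar\nu}g_{\alpha\bar\beta}\\&-(n+1)\left(\frac{u}{\sqrt[n]{a^n+u^n}}\right)^{n-1}\left(\frac{\bar z_\mu z_\beta}{u}g_{\alpha\bar\nu}+\frac{\bar z_\alpha z_\beta}{u}g_{\mu\bar\nu}+\frac{\bar z_\mu z_\nu}{u}g_{\alpha\bar\beta}+\frac{\bar z_\alpha z_\nu}{u}g_{\mu\bar\beta}\right)\\&+(n+1)(n+2)\left(\frac{u}{\sqrt[n]{a^n+u^n}}\right)^{2n-2}\frac{\bar z_\mu z_\nu\bar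 z_\alpha z_\beta}{u^2}\Bigg).\end{aligned}$$ 3. The Kretschmann scalar $K=\sum_{\mu,\nu,\alpha,\beta}R_{\mu\bar\nu\alpha\bar\beta}\,R^{\mu\bar\nu\alpha\bar\beta}$, where the indices of the curvature tensor are raised with the inverse of the metric (so that $K$ is the squared norm of $R_{\mu\bar\nu\alpha\bar\beta}$ with respect to $g$), is $$K=\frac{a^{2n}}{(a^n+u^n)^{2\left(\frac{n+1}{n}\right)}}\,n(n+2)(n^2-1).$$ In particular, for $n=2$, $K=\dfrac{24a^4}{(a^2+u^2)^3}$. -/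

import Mathlib

/-!
Tensor calculus on open subsets of `ℂⁿ` in the complex coordinate frame.

The complexified tangent space at a point has the basis
`∂_μ = ∂/∂z^μ`, `∂_{ν̄} = ∂/∂z̄^ν`. Its index set is `Fin n ⊕ Fin n`: `Sum.inl μ` is the holomorphic
index `μ` and `Sum.inr ν` is the antiholomorphic index `ν̄`.
-/

noncomputable section

namespace ComplexFrame

/-- Complex coordinate indices: `Sum.inl μ` stands for `μ`, `Sum.inr ν` for `ν̄`. -/
abbrev Idx (n : ℕ) : Type := Fin n ⊕ Fin n

/-- The Wirtinger derivatives
`∂f/∂z^μ = (∂f/∂x^μ - i ∂f/∂y^μ)/2` and `∂f/∂z̄^μ = (∂f/∂x^μ + i ∂f/∂y^μ)/2`,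
where `z^μ = x^μ + i y^μ`. -/
def wirtinger {n : ℕ} : Idx n → ((Fin n → ℂ) → ℂ) → (Fin n → ℂ) → ℂ
  | Sum.inl μ, f, z =>
      (1 / 2 : ℂ) * (fderiv ℝ f z (Pi.single μ 1)
        - Complex.I * fderiv ℝ f z (Pi.single μ Complex.I))
  | Sum.inr μ, f, z =>
      (1 / 2 : ℂ) * (fderiv ℝ f z (Pi.single μ 1)
        + Complex.I * fderiv ℝ f z (Pi.single μ Complex.I))

/-- The complex-bilinear extension of the Riemannian metric of a Hermitian metric with components
`g_{μν̄}`: its components are `G_{μν̄} = G_{ν̄μ} = g_{μν̄}` and `G_{μν} = G_{μ̄ν̄} = 0`. -/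
def bilinearExtension {n : ℕ} (g : (Fin n → ℂ) → Matrix (Fin n) (Fin n) ℂ) :
    (Fin n → ℂ) → Matrix (Idx n) (Idx n) ℂ :=
  fun z => Matrix.fromBlocks 0 (g z) (g z).transpose 0

/-- The Christoffel symbols `Γ^C_{AB}` of the Levi-Civita connection of `G`, with
`∇_{∂_A} ∂_B = Γ^C_{AB} ∂_C`:
`Γ^C_{AB} = ½ G^{CD} (∂_A G_{BD} + ∂_B G_{AD} - ∂_D G_{AB})`. -/
def christoffel {n : ℕ} (G : (Fin n → ℂ) → Matrix (Idx n) (Idx n) ℂ)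
    (C A B : Idx n) (z : Fin n → ℂ) : ℂ :=
  (1 / 2 : ℂ) * ∑ D, (G z)⁻¹ C D *
    (wirtinger A (fun w => G w B D) z + wirtinger B (fun w => G w A D) z - wirtinger D (fun w => G w A B) z)

/-- The component along `∂_D` of `R(∂_A, ∂_B) ∂_C`, where
`R(X, Y) = ∇_X ∇_Y - ∇_Y ∇_X - ∇_{[X, Y]}` for the Levi-Civita connection `∇` of `G`. -/
def curvatureOperator {n : ℕ} (G : (Fin n → ℂ) → Matrix (Idx n) (Idx n) ℂ)
    (D A B C : Idx n) (z : Fin n → ℂ) : ℂ :=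
  wirtinger A (christoffel G D B C) z - wirtinger B (christoffel G D A C) z
    + ∑ E, (christoffel G D A E z * christoffel G E B C z
      - christoffel G D B E z * christoffel G E A C z)

/-- The curvature tensor with all indices lowered,
`R_{ABCD} = G(R(∂_C, ∂_D) ∂_A, ∂_B)`. -/
def curvature {n : ℕ} (G : (Fin n → ℂ) → Matrix (Idx n) (Idx n) ℂ)
    (A B C D : Idx n) (z : Fin n → ℂ) : ℂ :=
  ∑ E, curvatureOperator G E C D A z * G z E B

/-- The curvature tensor with all indices raised by the inverse metric. -/
def curvatureRaised {n : ℕ} (G : (Fin n → ℂ) → Matrix (Idx n) (Idx n) ℂ)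
    (A B C D : Idx n) (z : Fin n → ℂ) : ℂ :=
  ∑ A', ∑ B', ∑ C', ∑ D',
    (G z)⁻¹ A A' * (G z)⁻¹ B B' * (G z)⁻¹ C C' * (G z)⁻¹ D D' * curvature G A' B' C' D' z

/-- The Kretschmann scalar in complex notation: the contraction of the components
`R_{μν̄αβ̄}` with the components of the raised curvature tensor in the same index slots
(these are obtained by raising `R_{σ̄ργ̄δ}`, the complex conjugate of `R_{σρ̄γδ̄}`). -/
def kretschmann {n : ℕ} (G : (Fin n → ℂ) → Matrix (Idx n) (Idx n) ℂ) (z : Fin n → ℂ) : ℂ :=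
  ∑ μ : Fin n, ∑ ν : Fin n, ∑ α : Fin n, ∑ β : Fin n,
    curvature G (Sum.inl μ) (Sum.inr ν) (Sum.inl α) (Sum.inr β) z *
      curvatureRaised G (Sum.inl μ) (Sum.inr ν) (Sum.inl α) (Sum.inr β) z

end ComplexFrame

namespace EguchiHanson

/-- `u = |z|²`, the squared Euclidean norm on `ℂⁿ`. -/
def sqNorm {n : ℕ} (z : Fin n → ℂ) : ℝ := ∑ μ, ‖z μ‖ ^ 2

/-- The Kronecker delta. -/
def delta {n : ℕ} (μ ν : Fin n) : ℂ := if μ = ν then 1 else 0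

/-- `z̄_μ`, the complex conjugate of the coordinate `z^μ`. -/
def zbar {n : ℕ} (z : Fin n → ℂ) (μ : Fin n) : ℂ := (starRingEnd ℂ) (z μ)

/-- The components `g_{μν̄}` of the Calabi–Eguchi–Hanson metric with parameter `a`:
`g_{μν̄} = (1 + aⁿ/uⁿ)^{1/n} (δ_{μν} - aⁿ/(aⁿ + uⁿ) · z̄_μ z_ν / u)`. -/
def metric {n : ℕ} (a : ℝ) (z : Fin n → ℂ) : Matrix (Fin n) (Fin n) ℂ :=
  Matrix.of fun μ ν =>
    (((1 + a ^ n / sqNorm z ^ n) ^ (1 / (n : ℝ)) : ℝ) : ℂ) *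
      (delta μ ν
        - ((a ^ n / (a ^ n + sqNorm z ^ n) : ℝ) : ℂ) * (zbar z μ * z ν / (sqNorm z : ℂ)))

/-- The Calabi–Eguchi–Hanson metric as a complex-bilinear form on the complexified tangent
spaces of `ℂⁿ ∖ {0}`. -/
def fullMetric (n : ℕ) (a : ℝ) :
    (Fin n → ℂ) → Matrix (ComplexFrame.Idx n) (ComplexFrame.Idx n) ℂ :=
  ComplexFrame.bilinearExtension (metric a)

end EguchiHanson

end

/-!
The metric is `U(n)`-invariant: `g = P(u) (δ_{μν} + A(u) z̄_μ z_ν)` with `u = |z|²`. It is Kähler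
because `P' = P A`, so in the complex frame only `Γ = ∂g · g⁻¹` and its conjugate survive, and the
curvature is `R = -(∂̄Γ) g`. Invariance forces `R` to be a combination of the symmetrised products
of `g` with itself, of `g` with the projector `T` onto the complex line through `z`, and of `T` with
itself. The pairings of these tensors are polynomials in traces of products of `1` and `T`, that
is, in `n` and `1`, which gives the Kretschmann scalar from the three coefficients. For the
Calabi–Eguchi–Hanson profile the coefficients follow from the derivatives of
`P = (1 + aⁿ/uⁿ)^{1/n}` and `A = -aⁿ/(u (aⁿ + uⁿ))`.
-/

namespace ComplexFrame

open EguchiHanson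
open scoped Matrix

section Wirtinger

variable {n : ℕ} {A : Idx n} {f g : (Fin n → ℂ) → ℂ} {f' g' : ℂ} {z : Fin n → ℂ}

/-- The complex-linear functional sending the real Fréchet derivative of a function to its
Wirtinger derivative in the direction `∂_A`. -/
noncomputable def wirtingerFunctional (A : Idx n) :
    ((Fin n → ℂ) →L[ℝ] ℂ) →ₗ[ℂ] ℂ where
  toFun L := A.elim
    (fun μ => 1 / 2 * (L (Pi.single μ 1) - Complex.I * L (Pi.single μ Complex.I)))
    (fun μ => 1 / 2 * (L (Pi.single μ 1) + Complex.I * L (Pi.single μ Complex.I)))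
  map_add' L M := by
    rcases A with μ | μ <;> simp only [Sum.elim_inl, Sum.elim_inr, add_apply] <;> ring
  map_smul' c L := by
    rcases A with μ | μ <;>
      simp only [Sum.elim_inl, Sum.elim_inr, smul_apply, smul_eq_mul,
        RingHom.id_apply] <;> ring

theorem wirtinger_eq_wirtingerFunctional (A : Idx n) (f : (Fin n → ℂ) → ℂ) (z : Fin n → ℂ) :
    wirtinger A f z = wirtingerFunctional A (fderiv ℝ f z) := by
  rcases A with μ | μ <;> rfl

theorem wirtinger_congr (h : f =ᶠ[nhds z] g) (A : Idx n) :
    wirtinger A f z = wirtinger A g z := by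
  rw [wirtinger_eq_wirtingerFunctional, wirtinger_eq_wirtingerFunctional, h.fderiv_eq]

/-- `f` is real differentiable at `z` and its Wirtinger derivative in the direction `∂_A` is
`f'`. -/
def HasWirtingerDerivAt (A : Idx n) (f : (Fin n → ℂ) → ℂ) (f' : ℂ) (z : Fin n → ℂ) : Prop :=
  ∃ L, HasFDerivAt (𝕜 := ℝ) f L z ∧ wirtingerFunctional A L = f'

namespace HasWirtingerDerivAt

theorem wirtinger_eq (hf : HasWirtingerDerivAt A f f' z) : wirtinger A f z = f' := by
  obtain ⟨L, hL, rfl⟩ := hf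
  rw [wirtinger_eq_wirtingerFunctional, hL.fderiv]

theorem const (A : Idx n) (c : ℂ) (z : Fin n → ℂ) : HasWirtingerDerivAt A (fun _ => c) 0 z :=
  ⟨0, hasFDerivAt_const c z, map_zero _⟩

theorem add (hf : HasWirtingerDerivAt A f f' z) (hg : HasWirtingerDerivAt A g g' z) :
    HasWirtingerDerivAt A (fun w => f w + g w) (f' + g') z := by
  obtain ⟨L, hL, rfl⟩ := hf
  obtain ⟨M, hM, rfl⟩ := hg
  exact ⟨L + M, hL.fun_add hM, map_add _ L M⟩

theorem mul (hf : HasWirtingerDerivAt A f f' z) (hg : HasWirtingerDerivAt A g g' z) :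
    HasWirtingerDerivAt A (fun w => f w * g w) (f' * g z + f z * g') z := by
  obtain ⟨L, hL, rfl⟩ := hf
  obtain ⟨M, hM, rfl⟩ := hg
  refine ⟨_, hL.fun_mul hM, ?_⟩
  rw [map_add, map_smul, map_smul, smul_eq_mul, smul_eq_mul]
  ring

theorem sum {ι : Type*} (s : Finset ι) {F : ι → (Fin n → ℂ) → ℂ} {F' : ι → ℂ}
    (h : ∀ i ∈ s, HasWirtingerDerivAt A (F i) (F' i) z) :
    HasWirtingerDerivAt A (fun w => ∑ i ∈ s, F i w) (∑ i ∈ s, F' i) z := by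
  choose! L hL hF' using h
  exact ⟨∑ i ∈ s, L i, .fun_sum hL, by rw [map_sum, Finset.sum_congr rfl hF']⟩

theorem ofReal_comp {r : (Fin n → ℂ) → ℝ} {r' : ℂ} {φ : ℝ → ℝ} {φ' : ℝ}
    (hφ : HasDerivAt φ φ' (r z)) (hr : HasWirtingerDerivAt A (fun w => (r w : ℂ)) r' z) :
    HasWirtingerDerivAt A (fun w => (φ (r w) : ℂ)) (φ' * r') z := by
  obtain ⟨L, hL, rfl⟩ := hr
  have hr : HasFDerivAt r (fderiv ℝ r z) z :=
    (Complex.reCLM.differentiableAt.comp z hL.differentiableAt).hasFDerivAt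
  have hL' : L = Complex.ofRealCLM.comp (fderiv ℝ r z) :=
    hL.unique (Complex.ofRealCLM.hasFDerivAt.comp z hr)
  refine ⟨(φ' : ℂ) • L, ?_, map_smul _ _ _⟩
  refine (Complex.ofRealCLM.hasFDerivAt.comp z (hφ.comp_hasFDerivAt z hr)).congr_fderiv ?_
  ext v
  simp [hL']

end HasWirtingerDerivAt

/-- Complex conjugation of indices, `μ ↦ μ̄` and `ν̄ ↦ ν`. -/
def conjIdx : Idx n ≃ Idx n := Equiv.sumComm _ _

@[simp] theorem conjIdx_inl (μ : Fin n) : conjIdx (Sum.inl μ) = Sum.inr μ := rfl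

@[simp] theorem conjIdx_inr (μ : Fin n) : conjIdx (Sum.inr μ) = Sum.inl μ := rfl

theorem wirtingerFunctional_conj (A : Idx n) (L : (Fin n → ℂ) →L[ℝ] ℂ) :
    wirtingerFunctional (conjIdx A) ((Complex.conjCLE : ℂ →L[ℝ] ℂ).comp L) =
      star (wirtingerFunctional A L) := by
  rcases A with μ | μ <;> simp [wirtingerFunctional, sub_eq_add_neg]

theorem HasWirtingerDerivAt.star (hf : HasWirtingerDerivAt A f f' z) :
    HasWirtingerDerivAt (conjIdx A) (fun w => star (f w)) (star f') z := by
  obtain ⟨L, hL, rfl⟩ := hf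
  exact ⟨_, Complex.conjCLE.hasFDerivAt.comp z hL, wirtingerFunctional_conj A L⟩

theorem wirtinger_star (A : Idx n) (f : (Fin n → ℂ) → ℂ) (z : Fin n → ℂ) :
    wirtinger (conjIdx A) (fun w => star (f w)) z = star (wirtinger A f z) := by
  rw [wirtinger_eq_wirtingerFunctional, wirtinger_eq_wirtingerFunctional,
    ← wirtingerFunctional_conj]
  exact congrArg _ Complex.conjCLE.comp_fderiv

theorem hasWirtingerDerivAt_coord (A : Idx n) (μ : Fin n) (z : Fin n → ℂ) :
    HasWirtingerDerivAt A (fun w => w μ) (if A = Sum.inl μ then 1 else 0) z := by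
  refine ⟨.proj (R := ℝ) (φ := fun _ => ℂ) μ, hasFDerivAt_apply μ z, ?_⟩
  rcases A with α | α <;> rcases eq_or_ne μ α with rfl | h <;>
    simp [wirtingerFunctional, *, Ne.symm]
  norm_num

theorem hasWirtingerDerivAt_zbar (A : Idx n) (μ : Fin n) (z : Fin n → ℂ) :
    HasWirtingerDerivAt A (fun w => zbar w μ) (if A = Sum.inr μ then 1 else 0) z := by
  have h := (hasWirtingerDerivAt_coord (conjIdx A) μ z).star
  rcases A with α | α <;> simpa [conjIdx, zbar, apply_ite] using h

theorem zbar_dotProduct_self (z : Fin n → ℂ) : zbar z ⬝ᵥ z = (sqNorm z : ℂ) := by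
  simp [dotProduct, sqNorm, zbar, Complex.conj_mul']

theorem dotProduct_zbar_self (z : Fin n → ℂ) : z ⬝ᵥ zbar z = (sqNorm z : ℂ) :=
  (dotProduct_comm _ _).trans (zbar_dotProduct_self z)

theorem hasWirtingerDerivAt_sqNorm (A : Idx n) (z : Fin n → ℂ) :
    HasWirtingerDerivAt A (fun w => (sqNorm w : ℂ)) (Sum.elim (zbar z) z A) z := by
  simp only [← zbar_dotProduct_self, dotProduct]
  convert HasWirtingerDerivAt.sum Finset.univ fun μ _ =>
    (hasWirtingerDerivAt_zbar A μ z).mul (hasWirtingerDerivAt_coord A μ z) using 1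
  rcases A with α | α <;> simp

theorem hasWirtingerDerivAt_comp_sqNorm {φ : ℝ → ℝ} {φ' : ℝ} (A : Idx n)
    (hφ : HasDerivAt φ φ' (sqNorm z)) :
    HasWirtingerDerivAt A (fun w => (φ (sqNorm w) : ℂ)) (φ' * Sum.elim (zbar z) z A) z :=
  .ofReal_comp hφ (hasWirtingerDerivAt_sqNorm A z)

end Wirtinger

section Reality

variable {n : ℕ} {G : (Fin n → ℂ) → Matrix (Idx n) (Idx n) ℂ}

/-- `G` is the complexification of a field of real bilinear forms. -/
def IsReal (G : (Fin n → ℂ) → Matrix (Idx n) (Idx n) ℂ) : Prop :=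
  ∀ z A B, G z (conjIdx A) (conjIdx B) = star (G z A B)

namespace IsReal

theorem inv_apply_conjIdx (hG : IsReal G) (z : Fin n → ℂ) (A B : Idx n) :
    (G z)⁻¹ (conjIdx A) (conjIdx B) = star ((G z)⁻¹ A B) := by
  have hG' : (G z).submatrix conjIdx conjIdx = (G z)ᴴᵀ := by
    ext A B
    exact hG z A B
  have hinv : (G z)⁻¹.submatrix conjIdx conjIdx = (G z)⁻¹ᴴᵀ := by
    rw [← Matrix.inv_submatrix_equiv, hG', Matrix.conjTranspose_nonsing_inv,
      Matrix.transpose_nonsing_inv]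
  exact congrFun₂ hinv A B

theorem christoffel_conjIdx (hG : IsReal G) (C A B : Idx n) (z : Fin n → ℂ) :
    christoffel G (conjIdx C) (conjIdx A) (conjIdx B) z = star (christoffel G C A B z) := by
  unfold christoffel
  rw [← Equiv.sum_comp conjIdx]
  simp only [hG _ _ _, hG.inv_apply_conjIdx, wirtinger_star]
  simp

theorem curvatureOperator_conjIdx (hG : IsReal G) (D A B C : Idx n) (z : Fin n → ℂ) :
    curvatureOperator G (conjIdx D) (conjIdx A) (conjIdx B) (conjIdx C) z =
      star (curvatureOperator G D A B C z) := by
  have hΓ : ∀ C A B, christoffel G (conjIdx C) (conjIdx A) (conjIdx B) =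
      fun w => star (christoffel G C A B w) :=
    fun C A B => funext (hG.christoffel_conjIdx C A B)
  unfold curvatureOperator
  rw [← Equiv.sum_comp conjIdx]
  simp only [hΓ, wirtinger_star]
  simp

theorem curvature_conjIdx (hG : IsReal G) (A B C D : Idx n) (z : Fin n → ℂ) :
    curvature G (conjIdx A) (conjIdx B) (conjIdx C) (conjIdx D) z =
      star (curvature G A B C D z) := by
  unfold curvature
  rw [← Equiv.sum_comp conjIdx]
  simp only [hG.curvatureOperator_conjIdx, hG _ _ _]
  simp

end IsReal

theorem isReal_bilinearExtension {g : (Fin n → ℂ) → Matrix (Fin n) (Fin n) ℂ}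
    (hg : ∀ z, (g z).IsHermitian) : IsReal (bilinearExtension g) := by
  intro z A B
  have h : ∀ μ ν, star (g z μ ν) = g z ν μ := fun μ ν => (hg z).apply ν μ
  rcases A with μ | μ <;> rcases B with ν | ν <;> simp [bilinearExtension, -RCLike.star_def, h]

end Reality

section Kahler

variable {n : ℕ} {g : (Fin n → ℂ) → Matrix (Fin n) (Fin n) ℂ} {z : Fin n → ℂ}

theorem bilinearExtension_inv (hg : IsUnit (g z).det) :
    (bilinearExtension g z)⁻¹ = Matrix.fromBlocks 0 (g z)⁻¹ᵀ (g z)⁻¹ 0 := by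
  apply Matrix.inv_eq_right_inv
  simp only [bilinearExtension, Matrix.fromBlocks_multiply, zero_mul, mul_zero, zero_add, add_zero,
    Matrix.mul_nonsing_inv _ hg, ← Matrix.transpose_mul, Matrix.nonsing_inv_mul _ hg,
    Matrix.transpose_one, Matrix.fromBlocks_one]

/-- The metric `g` is nondegenerate at `z` and its Kähler form `i g_{μν̄} dz^μ ∧ dz̄^ν` is closed
at `z`. -/
structure IsKahlerAt (g : (Fin n → ℂ) → Matrix (Fin n) (Fin n) ℂ) (z : Fin n → ℂ) : Prop where
  isUnit_det : IsUnit (g z).det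
  wirtinger_inl_comm : ∀ μ α ν, wirtinger (Sum.inl μ) (fun w => g w α ν) z =
    wirtinger (Sum.inl α) (fun w => g w μ ν) z
  wirtinger_inr_comm : ∀ β μ ν, wirtinger (Sum.inr β) (fun w => g w μ ν) z =
    wirtinger (Sum.inr ν) (fun w => g w μ β) z

theorem wirtinger_const (A : Idx n) (c : ℂ) (z : Fin n → ℂ) : wirtinger A (fun _ => c) z = 0 :=
  (HasWirtingerDerivAt.const A c z).wirtinger_eq

namespace IsKahlerAt

theorem christoffel_inl_inl_inl (hg : IsKahlerAt g z) (l μ α : Fin n) :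
    christoffel (bilinearExtension g) (Sum.inl l) (Sum.inl μ) (Sum.inl α) z =
      ((fun ν => wirtinger (Sum.inl μ) (fun w => g w α ν) z) ᵥ* (g z)⁻¹) l := by
  unfold christoffel
  rw [bilinearExtension_inv hg.isUnit_det, Fintype.sum_sum_type]
  simp only [bilinearExtension, Matrix.fromBlocks_apply₁₁, Matrix.fromBlocks_apply₁₂,
    Matrix.zero_apply, zero_mul, Finset.sum_const_zero, zero_add, wirtinger_const, sub_zero,
    Matrix.transpose_apply, hg.wirtinger_inl_comm α μ, Matrix.vecMul, dotProduct, Finset.mul_sum]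
  exact Finset.sum_congr rfl fun ν _ => by ring

theorem christoffel_eq_of_vecMul_eq (hg : IsKahlerAt g z) {μ α : Fin n} {Γ : Fin n → ℂ}
    (hΓ : ∀ ν, wirtinger (Sum.inl μ) (fun w => g w α ν) z = (Γ ᵥ* g z) ν) (l : Fin n) :
    christoffel (bilinearExtension g) (Sum.inl l) (Sum.inl μ) (Sum.inl α) z = Γ l := by
  rw [hg.christoffel_inl_inl_inl, funext hΓ, Matrix.vecMul_vecMul,
    Matrix.mul_nonsing_inv _ hg.isUnit_det, Matrix.vecMul_one]

theorem christoffel_inr_inl_inl (hg : IsKahlerAt g z) (l μ α : Fin n) :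
    christoffel (bilinearExtension g) (Sum.inr l) (Sum.inl μ) (Sum.inl α) z = 0 := by
  unfold christoffel
  rw [bilinearExtension_inv hg.isUnit_det, Fintype.sum_sum_type]
  simp [bilinearExtension, wirtinger_const]

theorem christoffel_inl_inr_inl (hg : IsKahlerAt g z) (l β μ : Fin n) :
    christoffel (bilinearExtension g) (Sum.inl l) (Sum.inr β) (Sum.inl μ) z = 0 := by
  unfold christoffel
  rw [bilinearExtension_inv hg.isUnit_det, Fintype.sum_sum_type]
  simp [bilinearExtension, wirtinger_const, hg.wirtinger_inr_comm β μ]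

theorem christoffel_inr_inr_inl (hg : IsKahlerAt g z) (l β μ : Fin n) :
    christoffel (bilinearExtension g) (Sum.inr l) (Sum.inr β) (Sum.inl μ) z = 0 := by
  unfold christoffel
  rw [bilinearExtension_inv hg.isUnit_det, Fintype.sum_sum_type]
  simp [bilinearExtension, wirtinger_const, hg.wirtinger_inl_comm μ]

end IsKahlerAt

/-- The components `R_{μν̄αβ̄}` of the curvature of a Hermitian metric, which determine the whole
curvature tensor when the metric is Kähler. -/
noncomputable def hermitianCurvature (g : (Fin n → ℂ) → Matrix (Fin n) (Fin n) ℂ)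
    (z : Fin n → ℂ) (μ ν α β : Fin n) : ℂ :=
  curvature (bilinearExtension g) (Sum.inl μ) (Sum.inr ν) (Sum.inl α) (Sum.inr β) z

theorem hermitianCurvature_eq_of_isKahlerAt (hg : ∀ᶠ w in nhds z, IsKahlerAt g w)
    (μ ν α β : Fin n) :
    hermitianCurvature g z μ ν α β =
      -((fun l => wirtinger (Sum.inr β)
        (christoffel (bilinearExtension g) (Sum.inl l) (Sum.inl α) (Sum.inl μ)) z) ᵥ* g z) ν := by
  have hmixed (l : Fin n) : wirtinger (Sum.inl α)
      (christoffel (bilinearExtension g) (Sum.inl l) (Sum.inr β) (Sum.inl μ)) z = 0 := by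
    rw [wirtinger_congr (hg.mono fun w hw => hw.christoffel_inl_inr_inl l β μ), wirtinger_const]
  have hz := hg.self_of_nhds
  unfold hermitianCurvature curvature curvatureOperator
  simp only [Fintype.sum_sum_type, hmixed, hz.christoffel_inl_inr_inl, hz.christoffel_inr_inr_inl,
    hz.christoffel_inr_inl_inl]
  simp [bilinearExtension, Matrix.vecMul, dotProduct]

end Kahler

section Contraction

variable {ι R : Type*} [CommRing R]

/-- The tensor `X_{μν̄} Y_{αβ̄} + X_{αν̄} Y_{μβ̄}`, the product of `X` and `Y` symmetrised in the
holomorphic indices `μ` and `α`. -/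
def symProd (X Y : Matrix ι ι R) (μ ν α β : ι) : R := X μ ν * Y α β + X α ν * Y μ β

theorem star_symProd [StarRing R] {X Y : Matrix ι ι R} (hX : X.IsHermitian)
    (hY : Y.IsHermitian) : star (symProd X Y) = symProd Xᵀ Yᵀ := by
  funext μ ν α β
  simp only [Pi.star_apply, symProd, star_add, star_mul', hX.apply, hY.apply,
    Matrix.transpose_apply]

variable [Fintype ι]

/-- The full contraction of the tensors `C_{μν̄αβ̄}` and `D_{σ̄ργ̄δ}`, after the indices of `D` are
raised with the matrix `H` of the inverse metric. -/
def contraction (H : Matrix ι ι R) :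
    (ι → ι → ι → ι → R) →ₗ[R] (ι → ι → ι → ι → R) →ₗ[R] R :=
  LinearMap.mk₂ R
    (fun C D => ∑ μ, ∑ ν, ∑ α, ∑ β, C μ ν α β *
      ∑ σ, ∑ ρ, ∑ γ, ∑ δ, H σ μ * H ν ρ * H γ α * H β δ * D σ ρ γ δ)
    (fun _ _ _ => by simp only [Pi.add_apply, add_mul, Finset.sum_add_distrib])
    (fun _ _ _ => by simp only [Pi.smul_apply, smul_eq_mul, mul_assoc, Finset.mul_sum])
    (fun _ _ _ => by simp only [Pi.add_apply, mul_add, Finset.sum_add_distrib])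
    (fun _ _ _ => by
      simp only [Pi.smul_apply, smul_eq_mul, mul_left_comm _ (_ : R), Finset.mul_sum])

theorem sum_swap_fst_thd (F : ι → ι → ι → ι → R) :
    ∑ μ, ∑ ν, ∑ α, ∑ β, F μ ν α β = ∑ μ, ∑ ν, ∑ α, ∑ β, F α ν μ β := by
  rw [Finset.sum_comm]
  conv_rhs => rw [Finset.sum_comm]
  exact Finset.sum_congr rfl fun ν _ => Finset.sum_comm

theorem sum_mul_symProd (H X Y : Matrix ι ι R) (μ ν α β : ι) :
    ∑ σ, ∑ ρ, ∑ γ, ∑ δ, H σ μ * H ν ρ * H γ α * H β δ * symProd X Y σ ρ γ δ =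
      symProd (Hᵀ * X * Hᵀ) (Hᵀ * Y * Hᵀ) μ ν α β := by
  have hprod (μ α : ι) : ∑ σ, ∑ ρ, ∑ γ, ∑ δ,
      H σ μ * H ν ρ * H γ α * H β δ * (X σ ρ * Y γ δ) =
        (Hᵀ * X * Hᵀ) μ ν * (Hᵀ * Y * Hᵀ) α β := by
    have hsandwich (Z : Matrix ι ι R) (κ l : ι) :
        (Hᵀ * Z * Hᵀ) κ l = ∑ σ, ∑ ρ, H σ κ * Z σ ρ * H l ρ := by
      simp only [Matrix.mul_apply, Matrix.transpose_apply, Finset.sum_mul]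
      exact Finset.sum_comm
    simp only [hsandwich, Finset.sum_mul]
    simp only [Finset.mul_sum]
    refine Finset.sum_congr rfl fun σ _ => Finset.sum_congr rfl fun ρ _ =>
      Finset.sum_congr rfl fun γ _ => Finset.sum_congr rfl fun δ _ => by ring
  have hswapped : ∑ σ, ∑ ρ, ∑ γ, ∑ δ, H σ μ * H ν ρ * H γ α * H β δ * (X γ ρ * Y σ δ) =
      ∑ σ, ∑ ρ, ∑ γ, ∑ δ, H σ α * H ν ρ * H γ μ * H β δ * (X σ ρ * Y γ δ) := by
    rw [sum_swap_fst_thd]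
    simp only [mul_comm, mul_left_comm]
  simp only [symProd, mul_add, Finset.sum_add_distrib, hprod, hswapped]

theorem sum_symProd_mul_symProd_transpose (X Y Z W : Matrix ι ι R) :
    ∑ μ, ∑ ν, ∑ α, ∑ β, symProd X Y μ ν α β * symProd Zᵀ Wᵀ μ ν α β =
      2 * ((X * Z).trace * (Y * W).trace + (X * Z * (Y * W)).trace) := by
  have hdirect : ∑ μ, ∑ ν, ∑ α, ∑ β, X μ ν * Y α β * (Z ν μ * W β α) =
      (X * Z).trace * (Y * W).trace := by
    simp only [Matrix.trace, Matrix.diag_apply, Matrix.mul_apply, Finset.sum_mul]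
    simp only [Finset.mul_sum]
    exact Finset.sum_congr rfl fun μ _ => Finset.sum_congr rfl fun ν _ =>
      Finset.sum_congr rfl fun α _ => Finset.sum_congr rfl fun β _ => by ring
  have hcrossed : ∑ μ, ∑ ν, ∑ α, ∑ β, X μ ν * Y α β * (Z ν α * W β μ) =
      (X * Z * (Y * W)).trace := by
    simp only [Matrix.trace, Matrix.diag_apply, Matrix.mul_apply, Finset.sum_mul_sum]
    refine Finset.sum_congr rfl fun μ _ => Finset.sum_comm.trans <| Finset.sum_congr rfl
      fun α _ => Finset.sum_congr rfl fun ν _ => Finset.sum_congr rfl fun β _ => by ring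
  have hhalf : ∑ μ, ∑ ν, ∑ α, ∑ β, X α ν * Y μ β * symProd Zᵀ Wᵀ μ ν α β =
      ∑ μ, ∑ ν, ∑ α, ∑ β, X μ ν * Y α β * symProd Zᵀ Wᵀ μ ν α β := by
    rw [sum_swap_fst_thd]
    simp only [symProd, add_comm]
  have hsplit (μ ν α β : ι) (s : R) :
      symProd X Y μ ν α β * s = X μ ν * Y α β * s + X α ν * Y μ β * s := add_mul _ _ _
  calc ∑ μ, ∑ ν, ∑ α, ∑ β, symProd X Y μ ν α β * symProd Zᵀ Wᵀ μ ν α β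
      = (∑ μ, ∑ ν, ∑ α, ∑ β, X μ ν * Y α β * symProd Zᵀ Wᵀ μ ν α β) +
          ∑ μ, ∑ ν, ∑ α, ∑ β, X α ν * Y μ β * symProd Zᵀ Wᵀ μ ν α β := by
        simp only [hsplit, Finset.sum_add_distrib]
    _ = 2 * ∑ μ, ∑ ν, ∑ α, ∑ β, X μ ν * Y α β * symProd Zᵀ Wᵀ μ ν α β := by
        rw [hhalf, two_mul]
    _ = 2 * ((X * Z).trace * (Y * W).trace + (X * Z * (Y * W)).trace) := by
        simp only [symProd, Matrix.transpose_apply, mul_add, Finset.sum_add_distrib, hdirect,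
          hcrossed]

theorem contraction_symProd_symProd_transpose (H X Y Z W : Matrix ι ι R) :
    contraction H (symProd X Y) (symProd Zᵀ Wᵀ) =
      2 * ((X * H * (Z * H)).trace * (Y * H * (W * H)).trace +
        (X * H * (Z * H) * (Y * H * (W * H))).trace) := by
  have hraise (V : Matrix ι ι R) : Hᵀ * Vᵀ * Hᵀ = (H * V * H)ᵀ := by
    simp only [Matrix.transpose_mul, mul_assoc]
  have hassoc (U V : Matrix ι ι R) : U * (H * V * H) = U * H * (V * H) := by
    simp only [mul_assoc]
  rw [contraction, LinearMap.mk₂_apply]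
  simp only [sum_mul_symProd, hraise]
  rw [sum_symProd_mul_symProd_transpose, hassoc, hassoc]

theorem contraction_star_self_of_isIdempotentElem [DecidableEq ι] {g T H : Matrix ι ι ℂ}
    (hg : g.IsHermitian) (hT : T.IsHermitian) (hgH : g * H = 1)
    (hTH : IsIdempotentElem (T * H)) (htr : (T * H).trace = 1) (a b c : ℝ)
    {C : ι → ι → ι → ι → ℂ}
    (hC : C = (a : ℂ) • symProd g g + (b : ℂ) • (symProd g T + symProd T g)
      + (c : ℂ) • symProd T T) :
    contraction H C (star C) =
      ((2 * Fintype.card ι * (Fintype.card ι - 1) * a ^ 2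
        + 4 * (Fintype.card ι - 1) * (a + b) ^ 2 + 4 * (a + 2 * b + c) ^ 2 : ℝ) : ℂ) := by
  have hstar : star C = (a : ℂ) • symProd gᵀ gᵀ + (b : ℂ) • (symProd gᵀ Tᵀ + symProd Tᵀ gᵀ)
      + (c : ℂ) • symProd Tᵀ Tᵀ := by
    simp only [hC, star_add, star_smul, star_symProd hg hg, star_symProd hg hT,
      star_symProd hT hg, star_symProd hT hT, RCLike.star_def, Complex.conj_ofReal]
  rw [hstar, hC]
  simp only [map_add, map_smul, LinearMap.add_apply, LinearMap.smul_apply, smul_eq_mul,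
    contraction_symProd_symProd_transpose, hgH, hTH.eq, mul_one, one_mul, htr, Matrix.trace_one]
  push_cast
  ring

end Contraction

section Kretschmann

variable {n : ℕ} {g : (Fin n → ℂ) → Matrix (Fin n) (Fin n) ℂ} {z : Fin n → ℂ}

theorem kretschmann_bilinearExtension (hH : ∀ z, (g z).IsHermitian) (hg : IsUnit (g z).det) :
    kretschmann (bilinearExtension g) z =
      contraction (g z)⁻¹ (hermitianCurvature g z) (star (hermitianCurvature g z)) := by
  have hstar (σ ρ γ δ : Fin n) : star (hermitianCurvature g z) σ ρ γ δ =
      curvature (bilinearExtension g) (Sum.inr σ) (Sum.inl ρ) (Sum.inr γ) (Sum.inl δ) z :=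
    ((isReal_bilinearExtension hH).curvature_conjIdx _ _ _ _ z).symm
  simp only [kretschmann, contraction, LinearMap.mk₂_apply, hstar]
  unfold curvatureRaised
  simp only [bilinearExtension_inv hg, Fintype.sum_sum_type, Matrix.fromBlocks_apply₁₁,
    Matrix.fromBlocks_apply₁₂, Matrix.fromBlocks_apply₂₁, Matrix.fromBlocks_apply₂₂,
    Matrix.zero_apply, zero_mul, mul_zero, Finset.sum_const_zero, zero_add, add_zero,
    Matrix.transpose_apply]
  rfl

end Kretschmann

section Radial

variable {n : ℕ} {P A B : ℝ → ℝ} {z : Fin n → ℂ}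

/-- The `U(n)`-invariant Hermitian metric `g_{μν̄} = P(u) (δ_{μν} + A(u) z̄_μ z_ν)`, `u = |z|²`. -/
noncomputable def radialMetric (P A : ℝ → ℝ) (z : Fin n → ℂ) : Matrix (Fin n) (Fin n) ℂ :=
  (P (sqNorm z) : ℂ) • (1 + (A (sqNorm z) : ℂ) • Matrix.vecMulVec (zbar z) z)

/-- The conditions on the profiles `P`, `A` under which `radialMetric P A` is nondegenerate
(`1 + t A` is the eigenvalue ratio in the direction of `z`) and Kähler (`P' = P A`) where
`|z|² = t`. The function `B` names the quantity `(A' - A²) / (1 + t A)`, which is the coefficient of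
`z̄_μ z̄_α z^λ` in the Christoffel symbols. -/
structure IsRadialKahlerAt (P A B : ℝ → ℝ) (t : ℝ) : Prop where
  conformal_ne_zero : P t ≠ 0
  one_add_mul_ne_zero : 1 + t * A t ≠ 0
  hasDerivAt_conformal : HasDerivAt P (P t * A t) t
  hasDerivAt_radial : HasDerivAt A (A t ^ 2 + (1 + t * A t) * B t) t

theorem radialMetric_apply (P A : ℝ → ℝ) (z : Fin n → ℂ) (μ ν : Fin n) :
    radialMetric P A z μ ν = (P (sqNorm z) : ℂ) *
      ((1 : Matrix (Fin n) (Fin n) ℂ) μ ν + (A (sqNorm z) : ℂ) * (zbar z μ * z ν)) := rfl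

theorem isHermitian_vecMulVec_zbar (z : Fin n → ℂ) :
    (Matrix.vecMulVec (zbar z) z).IsHermitian := by
  ext μ ν
  simp [Matrix.vecMulVec_apply, zbar, mul_comm]

theorem isHermitian_ofReal_smul {M : Matrix (Fin n) (Fin n) ℂ} (hM : M.IsHermitian) (r : ℝ) :
    ((r : ℂ) • M).IsHermitian :=
  hM.smul (Complex.conj_ofReal r)

theorem isHermitian_radialMetric (P A : ℝ → ℝ) (z : Fin n → ℂ) :
    (radialMetric P A z).IsHermitian :=
  isHermitian_ofReal_smul (Matrix.isHermitian_one.add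
    (isHermitian_ofReal_smul (isHermitian_vecMulVec_zbar z) _)) _

theorem vecMul_radialMetric (P A : ℝ → ℝ) (z : Fin n → ℂ) :
    z ᵥ* radialMetric P A z =
      ((P (sqNorm z) * (1 + sqNorm z * A (sqNorm z)) : ℝ) : ℂ) • z := by
  ext ν
  simp only [radialMetric, Matrix.vecMul_smul, Matrix.vecMul_add, Matrix.vecMul_one,
    Matrix.vecMul_vecMulVec, dotProduct_zbar_self, Pi.smul_apply, Pi.add_apply, smul_eq_mul]
  push_cast
  ring

theorem single_vecMul_radialMetric (P A : ℝ → ℝ) (z : Fin n → ℂ) (μ : Fin n) :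
    Pi.single μ 1 ᵥ* radialMetric P A z = radialMetric P A z μ :=
  Matrix.single_one_vecMul _ _

theorem det_radialMetric (P A : ℝ → ℝ) (z : Fin n → ℂ) :
    (radialMetric P A z).det =
      ((P (sqNorm z) ^ n * (1 + sqNorm z * A (sqNorm z)) : ℝ) : ℂ) := by
  rw [radialMetric, Matrix.det_smul, ← Matrix.smul_vecMulVec, Matrix.vecMulVec_eq Unit,
    Matrix.det_one_add_replicateCol_mul_replicateRow, dotProduct_smul, dotProduct_zbar_self,
    Fintype.card_fin]
  push_cast
  rw [smul_eq_mul, mul_comm (A _ : ℂ)]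

/-- The orthogonal projector onto the complex line through `z`, with its upper index lowered by
`radialMetric P A`. -/
noncomputable def radialProjector (P A : ℝ → ℝ) (z : Fin n → ℂ) : Matrix (Fin n) (Fin n) ℂ :=
  ((P (sqNorm z) * (1 + sqNorm z * A (sqNorm z)) / sqNorm z : ℝ) : ℂ) •
    Matrix.vecMulVec (zbar z) z

theorem isHermitian_radialProjector (P A : ℝ → ℝ) (z : Fin n → ℂ) :
    (radialProjector P A z).IsHermitian :=
  isHermitian_ofReal_smul (isHermitian_vecMulVec_zbar z) _

theorem trace_inv_sqNorm_smul_vecMulVec (hz : sqNorm z ≠ 0) :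
    ((sqNorm z : ℂ)⁻¹ • Matrix.vecMulVec (zbar z) z).trace = 1 := by
  rw [Matrix.trace_smul, Matrix.trace_vecMulVec, zbar_dotProduct_self, smul_eq_mul,
    inv_mul_cancel₀ (Complex.ofReal_ne_zero.2 hz)]

theorem isIdempotentElem_inv_sqNorm_smul_vecMulVec (hz : sqNorm z ≠ 0) :
    IsIdempotentElem ((sqNorm z : ℂ)⁻¹ • Matrix.vecMulVec (zbar z) z) := by
  rw [IsIdempotentElem, Matrix.smul_mul, Matrix.mul_smul, Matrix.vecMulVec_mul_vecMulVec,
    dotProduct_zbar_self, Matrix.vecMulVec_smul, inv_smul_smul₀ (Complex.ofReal_ne_zero.2 hz)]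

namespace IsRadialKahlerAt

theorem wirtinger_radialMetric (h : IsRadialKahlerAt P A B (sqNorm z)) (C : Idx n)
    (μ ν : Fin n) :
    wirtinger C (fun w => radialMetric P A w μ ν) z =
      A (sqNorm z) * Sum.elim (zbar z) z C * radialMetric P A z μ ν
      + P (sqNorm z) * ((A (sqNorm z) ^ 2 + (1 + sqNorm z * A (sqNorm z)) * B (sqNorm z)) *
          Sum.elim (zbar z) z C * (zbar z μ * z ν)
        + A (sqNorm z) * ((if C = Sum.inr μ then 1 else 0) * z ν
          + zbar z μ * (if C = Sum.inl ν then 1 else 0))) := by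
  simp only [radialMetric_apply]
  rw [((hasWirtingerDerivAt_comp_sqNorm C h.hasDerivAt_conformal).mul
    ((HasWirtingerDerivAt.const C _ z).add
      ((hasWirtingerDerivAt_comp_sqNorm C h.hasDerivAt_radial).mul
        ((hasWirtingerDerivAt_zbar C μ z).mul (hasWirtingerDerivAt_coord C ν z))))).wirtinger_eq]
  push_cast
  ring

theorem isKahlerAt (h : IsRadialKahlerAt P A B (sqNorm z)) : IsKahlerAt (radialMetric P A) z where
  isUnit_det := by
    rw [det_radialMetric, isUnit_iff_ne_zero, Complex.ofReal_ne_zero]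
    exact mul_ne_zero (pow_ne_zero n h.conformal_ne_zero) h.one_add_mul_ne_zero
  wirtinger_inl_comm μ α ν := by
    simp only [h.wirtinger_radialMetric]
    simp only [radialMetric_apply, Matrix.one_apply, Sum.elim_inl, Sum.inl.injEq, reduceCtorEq,
      if_false]
    ring
  wirtinger_inr_comm β μ ν := by
    simp only [h.wirtinger_radialMetric]
    simp only [radialMetric_apply, Matrix.one_apply, Sum.elim_inr, Sum.inr.injEq, reduceCtorEq,
      if_false, eq_comm (a := μ)]
    ring

theorem christoffel_radialMetric (h : IsRadialKahlerAt P A B (sqNorm z)) (l μ α : Fin n) :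
    christoffel (bilinearExtension (radialMetric P A)) (Sum.inl l) (Sum.inl μ) (Sum.inl α) z =
      A (sqNorm z) * (zbar z μ * (1 : Matrix (Fin n) (Fin n) ℂ) l α
        + zbar z α * (1 : Matrix (Fin n) (Fin n) ℂ) l μ)
      + B (sqNorm z) * (zbar z μ * zbar z α) * z l := by
  have hΓ : ∀ ν, wirtinger (Sum.inl μ) (fun w => radialMetric P A w α ν) z =
      (((A (sqNorm z) * zbar z μ : ℂ) • Pi.single α 1
        + (A (sqNorm z) * zbar z α : ℂ) • Pi.single μ 1
        + (B (sqNorm z) * (zbar z μ * zbar z α) : ℂ) • z) ᵥ* radialMetric P A z) ν := by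
    intro ν
    rw [h.wirtinger_radialMetric]
    simp only [Matrix.add_vecMul, Matrix.smul_vecMul, single_vecMul_radialMetric,
      vecMul_radialMetric, Pi.add_apply, Pi.smul_apply, smul_eq_mul, radialMetric_apply,
      Matrix.one_apply, Sum.elim_inl, Sum.inl.injEq, reduceCtorEq, if_false]
    push_cast
    ring
  rw [h.isKahlerAt.christoffel_eq_of_vecMul_eq hΓ]
  simp only [Pi.add_apply, Pi.smul_apply, smul_eq_mul, Pi.single_apply, Matrix.one_apply]
  ring

theorem wirtinger_christoffel_radialMetric {A' B' : ℝ}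
    (h : ∀ᶠ w in nhds z, IsRadialKahlerAt P A B (sqNorm w))
    (hA : HasDerivAt A A' (sqNorm z)) (hB : HasDerivAt B B' (sqNorm z)) (β α μ : Fin n) :
    (fun l => wirtinger (Sum.inr β) (christoffel (bilinearExtension (radialMetric P A))
        (Sum.inl l) (Sum.inl α) (Sum.inl μ)) z) =
      (A' * z β * zbar z α + A (sqNorm z) * (1 : Matrix (Fin n) (Fin n) ℂ) α β) • Pi.single μ 1
      + (A' * z β * zbar z μ + A (sqNorm z) * (1 : Matrix (Fin n) (Fin n) ℂ) μ β) • Pi.single α 1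
      + (B' * z β * (zbar z α * zbar z μ)
          + B (sqNorm z) * ((1 : Matrix (Fin n) (Fin n) ℂ) α β * zbar z μ
            + zbar z α * (1 : Matrix (Fin n) (Fin n) ℂ) μ β)) • z := by
  funext l
  have hzbar (κ : Fin n) := hasWirtingerDerivAt_zbar (Sum.inr β) κ z
  have hconst (c : ℂ) := HasWirtingerDerivAt.const (Sum.inr β) c z
  rw [wirtinger_congr (h.mono fun w hw => hw.christoffel_radialMetric l α μ),
    (((hasWirtingerDerivAt_comp_sqNorm _ hA).mul
      (((hzbar α).mul (hconst _)).add ((hzbar μ).mul (hconst _)))).add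
    (((hasWirtingerDerivAt_comp_sqNorm _ hB).mul ((hzbar α).mul (hzbar μ))).mul
      (hasWirtingerDerivAt_coord _ l z))).wirtinger_eq]
  simp only [Sum.elim_inr, Sum.inr.injEq, reduceCtorEq, if_false, Matrix.one_apply,
    eq_comm (a := β), Pi.add_apply, Pi.smul_apply, smul_eq_mul, Pi.single_apply]
  ring

theorem hermitianCurvature_radialMetric {B' : ℝ}
    (h : ∀ᶠ w in nhds z, IsRadialKahlerAt P A B (sqNorm w))
    (hB : HasDerivAt B B' (sqNorm z)) :
    hermitianCurvature (radialMetric P A) z =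
      ((-A (sqNorm z) / P (sqNorm z) : ℝ) : ℂ) •
        symProd (radialMetric P A z) (radialMetric P A z)
      + ((-((1 + sqNorm z * A (sqNorm z)) * B (sqNorm z)) : ℝ) : ℂ) •
        (symProd (radialMetric P A z) (Matrix.vecMulVec (zbar z) z)
          + symProd (Matrix.vecMulVec (zbar z) z) (radialMetric P A z))
      + ((-(P (sqNorm z) * (1 + sqNorm z * A (sqNorm z)) *
          (B' - 2 * A (sqNorm z) * B (sqNorm z)) / 2) : ℝ) : ℂ) •
        symProd (Matrix.vecMulVec (zbar z) z) (Matrix.vecMulVec (zbar z) z) := by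
  have hP : (P (sqNorm z) : ℂ) ≠ 0 := Complex.ofReal_ne_zero.2 h.self_of_nhds.conformal_ne_zero
  funext μ ν α β
  rw [hermitianCurvature_eq_of_isKahlerAt (h.mono fun w hw => hw.isKahlerAt),
    wirtinger_christoffel_radialMetric h h.self_of_nhds.hasDerivAt_radial hB]
  simp only [Matrix.add_vecMul, Matrix.smul_vecMul, single_vecMul_radialMetric,
    vecMul_radialMetric, Pi.add_apply, Pi.smul_apply, smul_eq_mul, symProd, radialMetric_apply,
    Matrix.vecMulVec_apply]
  push_cast
  field_simp
  ring

theorem vecMul_inv_radialMetric (h : IsRadialKahlerAt P A B (sqNorm z)) :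
    z ᵥ* (radialMetric P A z)⁻¹ =
      ((P (sqNorm z) * (1 + sqNorm z * A (sqNorm z)) : ℝ) : ℂ)⁻¹ • z := by
  have hx := mul_ne_zero h.conformal_ne_zero h.one_add_mul_ne_zero
  rw [eq_inv_smul_iff₀ (Complex.ofReal_ne_zero.2 hx), ← Matrix.smul_vecMul, ← vecMul_radialMetric,
    Matrix.vecMul_vecMul, Matrix.mul_nonsing_inv _ h.isKahlerAt.isUnit_det, Matrix.vecMul_one]

theorem radialProjector_mul_inv (h : IsRadialKahlerAt P A B (sqNorm z)) :
    radialProjector P A z * (radialMetric P A z)⁻¹ =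
      (sqNorm z : ℂ)⁻¹ • Matrix.vecMulVec (zbar z) z := by
  have hx := Complex.ofReal_ne_zero.2 (mul_ne_zero h.conformal_ne_zero h.one_add_mul_ne_zero)
  rw [radialProjector, Matrix.smul_mul, Matrix.vecMulVec_mul, h.vecMul_inv_radialMetric,
    Matrix.vecMulVec_smul, smul_smul, Complex.ofReal_div, div_mul_eq_mul_div, mul_inv_cancel₀ hx,
    one_div]

theorem hermitianCurvature_radialMetric_eq_radialProjector {B' : ℝ} (hz : sqNorm z ≠ 0)
    (h : ∀ᶠ w in nhds z, IsRadialKahlerAt P A B (sqNorm w))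
    (hB : HasDerivAt B B' (sqNorm z)) :
    hermitianCurvature (radialMetric P A) z =
      ((-A (sqNorm z) / P (sqNorm z) : ℝ) : ℂ) •
        symProd (radialMetric P A z) (radialMetric P A z)
      + ((-(sqNorm z * B (sqNorm z)) / P (sqNorm z) : ℝ) : ℂ) •
        (symProd (radialMetric P A z) (radialProjector P A z)
          + symProd (radialProjector P A z) (radialMetric P A z))
      + ((-(sqNorm z ^ 2 * (B' - 2 * A (sqNorm z) * B (sqNorm z))) /
          (2 * P (sqNorm z) * (1 + sqNorm z * A (sqNorm z))) : ℝ) : ℂ) •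
        symProd (radialProjector P A z) (radialProjector P A z) := by
  have hP := Complex.ofReal_ne_zero.2 h.self_of_nhds.conformal_ne_zero
  have hu := Complex.ofReal_ne_zero.2 hz
  rw [hermitianCurvature_radialMetric h hB]
  funext μ ν α β
  simp only [Pi.add_apply, Pi.smul_apply, smul_eq_mul, symProd, radialProjector,
    Matrix.smul_apply]
  push_cast
  field_simp

theorem kretschmann_radialMetric {B' : ℝ} (hz : sqNorm z ≠ 0)
    (h : ∀ᶠ w in nhds z, IsRadialKahlerAt P A B (sqNorm w))
    (hB : HasDerivAt B B' (sqNorm z)) :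
    kretschmann (bilinearExtension (radialMetric P A)) z =
      (((2 * n * (n - 1) * A (sqNorm z) ^ 2
          + 4 * (n - 1) * (A (sqNorm z) + sqNorm z * B (sqNorm z)) ^ 2
          + (2 * A (sqNorm z) + 4 * sqNorm z * B (sqNorm z)
            + sqNorm z ^ 2 * (B' - 2 * A (sqNorm z) * B (sqNorm z)) /
              (1 + sqNorm z * A (sqNorm z))) ^ 2) / P (sqNorm z) ^ 2 : ℝ) : ℂ) := by
  have hz' := h.self_of_nhds
  have hP := hz'.conformal_ne_zero
  have hdet := hz'.isKahlerAt.isUnit_det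
  have hproj := hz'.radialProjector_mul_inv
  rw [kretschmann_bilinearExtension (isHermitian_radialMetric P A) hdet,
    contraction_star_self_of_isIdempotentElem (isHermitian_radialMetric P A z)
      (isHermitian_radialProjector P A z) (Matrix.mul_nonsing_inv _ hdet)
      (hproj ▸ isIdempotentElem_inv_sqNorm_smul_vecMulVec hz)
      (hproj ▸ trace_inv_sqNorm_smul_vecMulVec hz) _ _ _
      (hermitianCurvature_radialMetric_eq_radialProjector hz h hB), Fintype.card_fin]
  congr 1
  field_simp
  ring

end IsRadialKahlerAt

end Radial

end ComplexFrame

namespace EguchiHanson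

open ComplexFrame

variable {n : ℕ} {a t : ℝ} {z : Fin n → ℂ}

theorem sqNorm_pos (hz : z ≠ 0) : 0 < sqNorm z := by
  obtain ⟨i, hi⟩ := Function.ne_iff.mp hz
  exact Finset.sum_pos' (fun j _ => sq_nonneg ‖z j‖)
    ⟨i, Finset.mem_univ i, sq_pos_of_ne_zero (norm_ne_zero_iff.mpr hi)⟩

theorem dim_ne_zero (hz : z ≠ 0) : n ≠ 0 := by
  obtain ⟨i, -⟩ := Function.ne_iff.mp hz
  exact i.pos.ne'

/-- The conformal factor `(1 + aⁿ/tⁿ)^{1/n}` of the Calabi–Eguchi–Hanson metric at `|z|² = t`. -/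
noncomputable def conformalFactor (n : ℕ) (a t : ℝ) : ℝ := (1 + a ^ n / t ^ n) ^ (1 / (n : ℝ))

/-- The coefficient `-aⁿ / (t (aⁿ + tⁿ))` of `z̄_μ z_ν` in the Calabi–Eguchi–Hanson metric at
`|z|² = t`, once the conformal factor is taken out. -/
noncomputable def radialCoeff (n : ℕ) (a t : ℝ) : ℝ := -(a ^ n / (t * (a ^ n + t ^ n)))

theorem metric_eq_radialMetric (n : ℕ) (a : ℝ) :
    metric (n := n) a = radialMetric (conformalFactor n a) (radialCoeff n a) := by
  funext z μ ν
  simp only [metric, Matrix.of_apply, radialMetric_apply, conformalFactor, radialCoeff, delta,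
    Matrix.one_apply, Complex.ofReal_neg, Complex.ofReal_mul, Complex.ofReal_inv, div_eq_mul_inv,
    mul_inv]
  ring

theorem one_add_pow_div_pow (n : ℕ) (a : ℝ) (ht : 0 < t) :
    1 + a ^ n / t ^ n = (a ^ n + t ^ n) / t ^ n := by
  rw [add_div, div_self (by positivity), add_comm]

theorem conformalFactor_pos (ha : 0 ≤ a) (ht : 0 < t) : 0 < conformalFactor n a t := by
  unfold conformalFactor
  positivity

theorem conformalFactor_eq (hn : n ≠ 0) (ha : 0 ≤ a) (ht : 0 < t) :
    conformalFactor n a t = (a ^ n + t ^ n) ^ (1 / (n : ℝ)) / t := by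
  rw [conformalFactor, one_add_pow_div_pow n a ht, Real.div_rpow (by positivity) (by positivity),
    one_div, Real.pow_rpow_inv_natCast ht.le hn]

theorem one_add_mul_radialCoeff (ha : 0 ≤ a) (ht : 0 < t) :
    1 + t * radialCoeff n a t = t ^ n / (a ^ n + t ^ n) := by
  have : a ^ n + t ^ n ≠ 0 := by positivity
  unfold radialCoeff
  field_simp
  ring

theorem conformalFactor_mul_one_add (hn : n ≠ 0) (ha : 0 ≤ a) (ht : 0 < t) :
    conformalFactor n a t * (1 + t * radialCoeff n a t) =
      (t / (a ^ n + t ^ n) ^ (1 / (n : ℝ))) ^ (n - 1) := by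
  rw [conformalFactor_eq hn ha ht, one_add_mul_radialCoeff ha ht]
  set s := (a ^ n + t ^ n) ^ (1 / (n : ℝ)) with hs
  have hs0 : 0 < s := by positivity
  have hsn : a ^ n + t ^ n = s ^ n := by
    rw [hs, one_div, Real.rpow_inv_natCast_pow (by positivity) hn]
  rw [hsn, ← div_pow, ← mul_pow_sub_one hn (t / s)]
  field_simp

theorem neg_radialCoeff_div_conformalFactor (hn : n ≠ 0) (ha : 0 ≤ a) (ht : 0 < t) :
    -radialCoeff n a t / conformalFactor n a t =
      a ^ n / (a ^ n + t ^ n) ^ (((n : ℝ) + 1) / (n : ℝ)) := by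
  have hn' : (n : ℝ) ≠ 0 := Nat.cast_ne_zero.2 hn
  have h0 : 0 < a ^ n + t ^ n := by positivity
  rw [conformalFactor_eq hn ha ht, add_div, div_self hn', Real.rpow_add h0, Real.rpow_one,
    radialCoeff]
  field_simp

theorem hasDerivAt_pow_of_ne_zero (n : ℕ) (ht : t ≠ 0) :
    HasDerivAt (fun x : ℝ => x ^ n) (n * t ^ n / t) t := by
  simpa [zpow_sub₀ ht, mul_div_assoc] using hasDerivAt_zpow n t (Or.inl ht)

theorem hasDerivAt_conformalFactor (hn : n ≠ 0) (ha : 0 ≤ a) (ht : 0 < t) :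
    HasDerivAt (conformalFactor n a) (conformalFactor n a t * radialCoeff n a t) t := by
  have hbase : 0 < 1 + a ^ n / t ^ n := by positivity
  have hderiv := ((((hasDerivAt_const t (a ^ n)).div (hasDerivAt_pow_of_ne_zero n ht.ne')
    (by positivity)).const_add 1).rpow_const (p := 1 / (n : ℝ)) (Or.inl hbase.ne'))
  refine hderiv.congr_deriv ?_
  have hn' : (n : ℝ) ≠ 0 := Nat.cast_ne_zero.2 hn
  have hsum : a ^ n + t ^ n ≠ 0 := by positivity
  rw [Pi.div_apply, Real.rpow_sub_one hbase.ne', conformalFactor, radialCoeff]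
  generalize (1 + a ^ n / t ^ n) ^ (1 / (n : ℝ)) = p
  rw [one_add_pow_div_pow n a ht]
  field_simp
  ring

theorem hasDerivAt_radialCoeff (ha : 0 ≤ a) (ht : 0 < t) :
    HasDerivAt (radialCoeff n a)
      (-(n * radialCoeff n a t ^ 2 + (n + 1) * radialCoeff n a t / t)) t := by
  have hsum : a ^ n + t ^ n ≠ 0 := by positivity
  have hderiv := ((hasDerivAt_const t (a ^ n)).div ((hasDerivAt_id t).mul
    ((hasDerivAt_pow_of_ne_zero n ht.ne').const_add (a ^ n))) (mul_ne_zero ht.ne' hsum)).neg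
  refine hderiv.congr_deriv ?_
  simp only [radialCoeff, Pi.mul_apply, id]
  field_simp
  ring

/-- The coefficient `(n + 1) aⁿ / (t² (aⁿ + tⁿ))` of `z̄_μ z̄_α z^λ` in the Christoffel symbols of
the Calabi–Eguchi–Hanson metric at `|z|² = t`. -/
noncomputable def christoffelCoeff (n : ℕ) (a t : ℝ) : ℝ := -((n + 1) * radialCoeff n a t / t)

theorem isRadialKahlerAt (hn : n ≠ 0) (ha : 0 ≤ a) (ht : 0 < t) :
    IsRadialKahlerAt (conformalFactor n a) (radialCoeff n a) (christoffelCoeff n a) t where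
  conformal_ne_zero := (conformalFactor_pos ha ht).ne'
  one_add_mul_ne_zero := by
    rw [one_add_mul_radialCoeff ha ht]
    positivity
  hasDerivAt_conformal := hasDerivAt_conformalFactor hn ha ht
  hasDerivAt_radial := (hasDerivAt_radialCoeff ha ht).congr_deriv <| by
    rw [christoffelCoeff]
    field_simp
    ring

theorem eventually_isRadialKahlerAt (ha : 0 ≤ a) (hz : z ≠ 0) :
    ∀ᶠ w in nhds z, IsRadialKahlerAt (conformalFactor n a) (radialCoeff n a)
      (christoffelCoeff n a) (sqNorm w) :=
  (isOpen_ne.eventually_mem hz).mono fun _ hw =>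
    isRadialKahlerAt (dim_ne_zero hw) ha (sqNorm_pos hw)

theorem hasDerivAt_christoffelCoeff (ha : 0 ≤ a) (ht : 0 < t) :
    HasDerivAt (christoffelCoeff n a)
      (2 * radialCoeff n a t * christoffelCoeff n a t
        + (n + 1) * (n + 2) * radialCoeff n a t * (1 + t * radialCoeff n a t) / t ^ 2) t := by
  have hderiv := (((hasDerivAt_radialCoeff (n := n) ha ht).const_mul ((n : ℝ) + 1)).div
    (hasDerivAt_id t) ht.ne').neg
  refine hderiv.congr_deriv ?_
  simp only [christoffelCoeff, id]
  field_simp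
  ring

theorem christoffel_fullMetric (ha : 0 ≤ a) (hz : z ≠ 0) (l μ α : Fin n) :
    christoffel (fullMetric n a) (Sum.inl l) (Sum.inl μ) (Sum.inl α) z =
      radialCoeff n a (sqNorm z) * (zbar z μ * delta l α + zbar z α * delta l μ
        - ((n : ℂ) + 1) * (zbar z α * zbar z μ / (sqNorm z : ℂ)) * z l) := by
  rw [fullMetric, metric_eq_radialMetric,
    (eventually_isRadialKahlerAt ha hz).self_of_nhds.christoffel_radialMetric, christoffelCoeff]
  simp only [Matrix.one_apply, delta]
  push_cast
  ring

theorem hermitianCurvature_metric (ha : 0 ≤ a) (hz : z ≠ 0) :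
    hermitianCurvature (metric a) z =
      ((-radialCoeff n a (sqNorm z) / conformalFactor n a (sqNorm z) : ℝ) : ℂ) •
        (symProd (metric a z) (metric a z)
          - (((n + 1) * (conformalFactor n a (sqNorm z) *
              (1 + sqNorm z * radialCoeff n a (sqNorm z))) / sqNorm z : ℝ) : ℂ) •
            (symProd (metric a z) (Matrix.vecMulVec (zbar z) z)
              + symProd (Matrix.vecMulVec (zbar z) z) (metric a z))
          + (((n + 1) * (n + 2) * (conformalFactor n a (sqNorm z) *
              (1 + sqNorm z * radialCoeff n a (sqNorm z))) ^ 2 / (2 * sqNorm z ^ 2) : ℝ) : ℂ) •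
            symProd (Matrix.vecMulVec (zbar z) z) (Matrix.vecMulVec (zbar z) z)) := by
  have hu := sqNorm_pos hz
  rw [metric_eq_radialMetric, IsRadialKahlerAt.hermitianCurvature_radialMetric
    (eventually_isRadialKahlerAt ha hz) (hasDerivAt_christoffelCoeff ha hu), add_sub_cancel_left]
  have hP : conformalFactor n a (sqNorm z) ≠ 0 := (conformalFactor_pos ha hu).ne'
  set A := radialCoeff n a (sqNorm z) with hA
  set P := conformalFactor n a (sqNorm z)
  set u := sqNorm z
  have hmixed : -((1 + u * A) * christoffelCoeff n a u) =
      -(-A / P * ((n + 1) * (P * (1 + u * A)) / u)) := by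
    rw [christoffelCoeff, ← hA]
    field_simp
  have hradial : -(P * (1 + u * A) * ((n + 1) * (n + 2) * A * (1 + u * A) / u ^ 2) / 2) =
      -A / P * ((n + 1) * (n + 2) * (P * (1 + u * A)) ^ 2 / (2 * u ^ 2)) := by
    field_simp
  rw [hmixed, hradial, Complex.ofReal_neg, Complex.ofReal_mul, Complex.ofReal_mul]
  module

theorem kretschmann_fullMetric (ha : 0 ≤ a) (hz : z ≠ 0) :
    kretschmann (fullMetric n a) z =
      ((a ^ (2 * n) / (a ^ n + sqNorm z ^ n) ^ (2 * (((n : ℝ) + 1) / (n : ℝ))) *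
        ((n : ℝ) * ((n : ℝ) + 2) * ((n : ℝ) ^ 2 - 1)) : ℝ) : ℂ) := by
  have hu := sqNorm_pos hz
  have h := eventually_isRadialKahlerAt ha hz
  have hpow : (a ^ n + sqNorm z ^ n) ^ (2 * (((n : ℝ) + 1) / (n : ℝ))) =
      ((a ^ n + sqNorm z ^ n) ^ (((n : ℝ) + 1) / (n : ℝ))) ^ 2 := by
    rw [← Real.rpow_mul_natCast (by positivity), mul_comm, Nat.cast_ofNat]
  rw [hpow, mul_comm 2 n, pow_mul, ← div_pow,
    ← neg_radialCoeff_div_conformalFactor (dim_ne_zero hz) ha hu, fullMetric,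
    metric_eq_radialMetric, IsRadialKahlerAt.kretschmann_radialMetric hu.ne' h
      (hasDerivAt_christoffelCoeff ha hu), add_sub_cancel_left]
  set A := radialCoeff n a (sqNorm z) with hA
  have hκ : 1 + sqNorm z * A ≠ 0 := h.self_of_nhds.one_add_mul_ne_zero
  have hB : sqNorm z * christoffelCoeff n a (sqNorm z) = -((n + 1) * A) := by
    rw [christoffelCoeff, ← hA]
    field_simp
  have hB' : sqNorm z ^ 2 * ((n + 1) * (n + 2) * A * (1 + sqNorm z * A) / sqNorm z ^ 2) /
      (1 + sqNorm z * A) = (n + 1) * (n + 2) * A := by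
    field_simp
  rw [hB', mul_assoc 4 (sqNorm z), hB]
  congr 1
  ring

end EguchiHanson

theorem mainTheorem4 (n : ℕ) (a : ℝ) (ha : 0 < a) (z : Fin n → ℂ) (hz : z ≠ 0)
    (u : ℝ) (hu : u = EguchiHanson.sqNorm z)
    (g : Matrix (Fin n) (Fin n) ℂ) (hg : g = EguchiHanson.metric a z) :
    (∀ l μ α : Fin n,
      ComplexFrame.christoffel (EguchiHanson.fullMetric n a)
          (Sum.inl l) (Sum.inl μ) (Sum.inl α) z =
        -((a ^ n / (u * (a ^ n + u ^ n)) : ℝ) : ℂ) *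
          (EguchiHanson.zbar z μ * EguchiHanson.delta l α
            + EguchiHanson.zbar z α * EguchiHanson.delta l μ
            - ((n : ℂ) + 1) * (EguchiHanson.zbar z α * EguchiHanson.zbar z μ / (u : ℂ)) * z l)) ∧
    (∀ μ ν α β : Fin n,
      ComplexFrame.curvature (EguchiHanson.fullMetric n a)
          (Sum.inl μ) (Sum.inr ν) (Sum.inl α) (Sum.inr β) z =
        ((a ^ n / (a ^ n + u ^ n) ^ (((n : ℝ) + 1) / (n : ℝ)) : ℝ) : ℂ) *
          (g α ν * g μ β + g μ ν * g α β
            - ((n : ℂ) + 1) *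
              (((u / (a ^ n + u ^ n) ^ (1 / (n : ℝ))) ^ (n - 1) : ℝ) : ℂ) *
              (EguchiHanson.zbar z μ * z β / (u : ℂ) * g α ν
                + EguchiHanson.zbar z α * z β / (u : ℂ) * g μ ν
                + EguchiHanson.zbar z μ * z ν / (u : ℂ) * g α β
                + EguchiHanson.zbar z α * z ν / (u : ℂ) * g μ β)
            + ((n : ℂ) + 1) * ((n : ℂ) + 2) *
              (((u / (a ^ n + u ^ n) ^ (1 / (n : ℝ))) ^ (2 * n - 2) : ℝ) : ℂ) *
              (EguchiHanson.zbar z μ * z ν * EguchiHanson.zbar z α * z β / (u : ℂ) ^ 2))) ∧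
    ComplexFrame.kretschmann (EguchiHanson.fullMetric n a) z =
      ((a ^ (2 * n) / (a ^ n + u ^ n) ^ (2 * (((n : ℝ) + 1) / (n : ℝ))) *
        ((n : ℝ) * ((n : ℝ) + 2) * ((n : ℝ) ^ 2 - 1)) : ℝ) : ℂ) ∧
    (n = 2 →
      ComplexFrame.kretschmann (EguchiHanson.fullMetric n a) z =
        ((24 * a ^ 4 / (a ^ 2 + u ^ 2) ^ 3 : ℝ) : ℂ)) := by
  subst hu hg
  have hu := EguchiHanson.sqNorm_pos hz
  have hn := EguchiHanson.dim_ne_zero hz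
  refine ⟨fun l μ α => ?_, fun μ ν α β => ?_, EguchiHanson.kretschmann_fullMetric ha.le hz, ?_⟩
  · rw [EguchiHanson.christoffel_fullMetric ha.le hz, EguchiHanson.radialCoeff, Complex.ofReal_neg]
  · change ComplexFrame.hermitianCurvature (EguchiHanson.metric a) z μ ν α β = _
    rw [EguchiHanson.hermitianCurvature_metric ha.le hz,
      EguchiHanson.neg_radialCoeff_div_conformalFactor hn ha.le hu,
      EguchiHanson.conformalFactor_mul_one_add hn ha.le hu,
      show 2 * n - 2 = (n - 1) * 2 by omega, pow_mul]
    simp only [Pi.smul_apply, Pi.add_apply, Pi.sub_apply, smul_eq_mul, ComplexFrame.symProd,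
      Matrix.vecMulVec_apply]
    push_cast
    ring
  · rintro rfl
    have hexp : (2 : ℝ) * (((2 : ℕ) + 1) / (2 : ℕ)) = (3 : ℕ) := by norm_num
    rw [EguchiHanson.kretschmann_fullMetric ha.le hz, hexp, Real.rpow_natCast]
    congr 1
    push_cast
    ring
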